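/- **Conventions.** LTL formulas over a set $P$ of propositional variables are built from $\mathrm{TRUE}$, $\mathrm{FALSE}$, $p\in P$, $\neg,\wedge,\vee,X,U,W$ (weak until), with $F a=\mathrm{TRUE}\,U\,a$ and $G a=a\,W\,\mathrm{FALSE}$. They are interpreted as usual over structures $M\in(2^P)^{\mathbb N}$, and $f$ is satisfiable if $(M,0)\vDash f$ for some $M$. Formulas are in negation normal form ($\neg$ only in front of variables). **Unwinding.** A conjunction unwinds into *all* its maximal conjuncts $\psi_1,\dots,\psi_s$ (none of them a conjunction), and $Ga$ into *all* of $a, XGa$. A disjunction unwinds into *one of* its maximal disjuncts, $Fa$ into *one of* $a, XFa$, and $\psi=a\,U\,b$ or $\psi=a\,W\,b$ (not of the form $F$, $G$) into *one of* $b,\ a\wedge X\psi$. Other formulas do not unwind. The closure $Cl(f)$ is the smallest set that contains $f$, contains every formula into which a member may unwind, and contains $h$ whenever it contains $Xh$. For a set $PS$ of formulas, $StCl(PS)\supseteq PS$ is defined in the same way from $PS$, without the rule for $X$. **Tableau.** A *state derived from* $PS$ is a set $S$ such that, for some function $\rho$ choosing one alternative for each member of $S$ that unwinds disjunctively, $S$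 is the smallest set containing $PS$ and closed under unwinding with the choices $\rho$. The starting prestate of the $f$-tableau is $PS_0=\{f_1,\dots,f_n\}$, the set of maximal conjuncts of $f$. A state $S$ derives the prestate $\{h: Xh\in S\}$ if this set is nonempty, and its successors are the states derived from that prestate; otherwise it has no successor. A *path* is a nonempty sequence of states $S_0,S_1,\dots$, where $S_0$ is derived from $PS_0$ and each $S_{i+1}$ is a successor of $S_i$ (hence derived from the prestate $PS_{i+1}=\{h:Xh\in S_i\}$), that is infinite or ends in a state with no successor. It is *fair* if no $S_i$ contains $\mathrm{FALSE}$ or a pair $h,\neg h$, and whenever $a\,U\,b\in S_i$ (in particular $Fb\in S_i$), the promise operand $b$ belongs to $S_j$ for some $j\ge i$ on the path. **Fair prime implicants.** Introduce a Boolean variable $x_h$ for each $h\in StCl(PS)$, true in an assignment when $h$ is present; identify an assignment with the set of $h$ such that $x_h$ is true. $UCS(PS)$ consists of the unit clauses $x_h$ ($h\in PS$) and, for each $\psi\in StCl(PS)$, the clauses $x_\psi\Rightarrow x_\chi$ for each $\chi$ in a conjunctive unwinding of $\psi$, respectively the clause $x_\psi\Rightarrow\bigvee_\chi x_\chi$ over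 the alternatives $\chi$ of a disjunctive one. $AUX(PS)$ consists of the clauses $\neg x_h\vee\neg x_{\neg h}$ for $h,\neg h\in StCl(PS)$, and $\neg x_{\mathrm{FALSE}}$ if $\mathrm{FALSE}\in StCl(PS)$. An *instance* for $PS$ is an assignment satisfying $UCS(PS)\cup AUX(PS)$. A *fair prime implicant* (FPI) of an instance $IS$ is an instance obtained from $IS$ by switching to false an inclusion-maximal set of true variables $x_h$ such that $h$ is not a promise operand of $f$, i.e. there is no $a$ with $a\,U\,h\in Cl(f)$. **Theorem (fair prime implicant version of depth-first search).** Let $f$ be an LTL formula in negation normal form. Then $f$ is satisfiable if and only if the $f$-tableau has a fair path $S_0,S_1,\dots$ (finite or infinite) all of whose states are fair prime implicants, i.e. each $S_i$ is an FPI of some instance for the prestate $PS_i$ from which it is derived. -/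

import Mathlib

namespace LTL

/-- Formulas of linear temporal logic over the propositional variables `P`. -/
inductive Formula (P : Type*) where
  | tru : Formula P
  | fls : Formula P
  | var (p : P) : Formula P
  | not (a : Formula P) : Formula P
  | and (a b : Formula P) : Formula P
  | or (a b : Formula P) : Formula P
  | next (a : Formula P) : Formula P
  | untl (a b : Formula P) : Formula P
  | wuntl (a b : Formula P) : Formula P

variable {P : Type*}

namespace Formula

/-- `F a` abbreviates `TRUE U a`. -/
abbrev fut (a : Formula P) : Formula P := untl tru a

/-- `G a` abbreviates `a W FALSE`. -/
abbrev glob (a : Formula P) : Formula P := wuntl a fls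

/-- Negation normal form: negation is applied to propositional variables only. -/
def IsNNF : Formula P → Prop
  | tru => True
  | fls => True
  | var _ => True
  | not (var _) => True
  | not _ => False
  | and a b => a.IsNNF ∧ b.IsNNF
  | or a b => a.IsNNF ∧ b.IsNNF
  | next a => a.IsNNF
  | untl a b => a.IsNNF ∧ b.IsNNF
  | wuntl a b => a.IsNNF ∧ b.IsNNF

/-- `Holds M i a` : the formula `a` holds at time `i` of the linear time structure `M`. -/
def Holds (M : ℕ → Set P) : ℕ → Formula P → Prop
  | _, tru => True
  | _, fls => False
  | i, var p => p ∈ M i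
  | i, not a => ¬ Holds M i a
  | i, and a b => Holds M i a ∧ Holds M i b
  | i, or a b => Holds M i a ∨ Holds M i b
  | i, next a => Holds M (i + 1) a
  | i, untl a b => ∃ j, i ≤ j ∧ Holds M j b ∧ ∀ k, i ≤ k → k < j → Holds M k a
  | i, wuntl a b => (∀ j, i ≤ j → Holds M j a) ∨
      ∃ j, i ≤ j ∧ Holds M j b ∧ ∀ k, i ≤ k → k < j → Holds M k a

/-- Satisfiability: some linear time structure satisfies the formula at time `0`. -/
def Satisfiable (f : Formula P) : Prop := ∃ M : ℕ → Set P, Holds M 0 f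

/-- The maximal decomposition `ψ₁ ∧ … ∧ ψₛ` in which no `ψⱼ` is a conjunction. -/
def conjuncts : Formula P → List (Formula P)
  | and a b => a.conjuncts ++ b.conjuncts
  | a => [a]

/-- The maximal decomposition `ψ₁ ∨ … ∨ ψᵣ` in which no `ψⱼ` is a disjunction. -/
def disjuncts : Formula P → List (Formula P)
  | or a b => a.disjuncts ++ b.disjuncts
  | a => [a]

end Formula

open Formula

/-- The way a formula is unwound inside a state: not at all, into all the formulas of a list, or
into a chosen one of the formulas of a list. -/
inductive Unwinding (P : Type*) where
  | leaf : Unwinding P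
  | all (l : List (Formula P)) : Unwinding P
  | any (l : List (Formula P)) : Unwinding P

/-- The formulas that occur in an unwinding. -/
def Unwinding.parts : Unwinding P → List (Formula P)
  | .leaf => []
  | .all l => l
  | .any l => l

/-- The unwinding rules. The rules for `F a = TRUE U a` and `G a = a W FALSE` take precedence over
the general rules for `U` and `W`. -/
def unwind : Formula P → Unwinding P
  | .and a b => .all (Formula.and a b).conjuncts
  | .or a b => .any (Formula.or a b).disjuncts
  | .untl .tru b => .any [b, .next (fut b)]
  | .untl a b => .any [b, .and a (.next (.untl a b))]
  | .wuntl a .fls => .all [a, .next (glob a)]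
  | .wuntl a b => .any [b, .and a (.next (.wuntl a b))]
  | _ => .leaf

/-- The closure `Cl(f)`. -/
inductive Cl (f : Formula P) : Formula P → Prop
  | base : Cl f f
  | part {ψ χ : Formula P} : Cl f ψ → χ ∈ (unwind ψ).parts → Cl f χ
  | next {ψ : Formula P} : Cl f (Formula.next ψ) → Cl f ψ

/-- The state closure `StCl(PS)`: the same closure started from `PS`, without the rule for `X`. -/
inductive StCl (PS : Set (Formula P)) : Formula P → Prop
  | base {ψ : Formula P} : ψ ∈ PS → StCl PS ψ
  | part {ψ χ : Formula P} : StCl PS ψ → χ ∈ (unwind ψ).parts → StCl PS χ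

/-! The tableau -/

/-- The starting prestate: the conjuncts of `f`. -/
def initPrestate (f : Formula P) : Set (Formula P) := {h | h ∈ f.conjuncts}

/-- The prestate derived from a state. -/
def nextPrestate (S : Set (Formula P)) : Set (Formula P) := {h | next h ∈ S}

/-- `T` is closed under the unwinding rules, where `ρ` chooses, for every formula of `T` of
disjunctive type (disjunction, `F`, `U`, `W` but not `G`), one of its alternatives. -/
def ClosedUnder (ρ : Formula P → Formula P) (T : Set (Formula P)) : Prop :=
  (∀ ψ ∈ T, ∀ l, unwind ψ = .all l → ∀ χ ∈ l, χ ∈ T) ∧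
  (∀ ψ ∈ T, ∀ l, unwind ψ = .any l → ρ ψ ∈ l ∧ ρ ψ ∈ T)

/-- `S` is a state derived from the prestate `PS`: for some choice function it is the smallest
set that contains `PS` and is closed under the unwinding rules. -/
def IsStateFrom (PS S : Set (Formula P)) : Prop :=
  ∃ ρ : Formula P → Formula P, IsLeast {T | PS ⊆ T ∧ ClosedUnder ρ T} S

/-- The transitions `S → PS → S'` between states. A state without formulas `X h` derives no
prestate, hence has no successor. -/
def Transition (S S' : Set (Formula P)) : Prop :=
  (nextPrestate S).Nonempty ∧ IsStateFrom (nextPrestate S) S'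

/-- A set of formulas is conflicting if it contains `FALSE` or some `h` together with `¬ h`. -/
def Conflicting (S : Set (Formula P)) : Prop :=
  fls ∈ S ∨ ∃ h, h ∈ S ∧ Formula.not h ∈ S

/-- `(s i)`, `i < N`, is a maximal path of states of the `f`-tableau, entered from the starting
prestate: it is infinite (`N = ⊤`), or it is finite and its last state has no successor. -/
structure IsPath (f : Formula P) (N : ℕ∞) (s : ℕ → Set (Formula P)) : Prop where
  pos : 0 < N
  start : IsStateFrom (initPrestate f) (s 0)
  step : ∀ i : ℕ, ((i + 1 : ℕ) : ℕ∞) < N → Transition (s i) (s (i + 1))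
  last : ∀ i : ℕ, N = ((i + 1 : ℕ) : ℕ∞) → ∀ S', ¬ Transition (s i) S'

/-- A fair path: a path of non-conflicting states in which the promise operand `b` of every
occurrence of `a U b` (in particular of `F b = TRUE U b`) is fulfilled at that state or later. -/
structure IsFairPath (f : Formula P) (N : ℕ∞) (s : ℕ → Set (Formula P)) : Prop
    extends IsPath f N s where
  nonconflicting : ∀ i : ℕ, (i : ℕ∞) < N → ¬ Conflicting (s i)
  fulfilled : ∀ i : ℕ, (i : ℕ∞) < N → ∀ a b, untl a b ∈ s i →
    ∃ j : ℕ, i ≤ j ∧ (j : ℕ∞) < N ∧ b ∈ s j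

/-! The propositional problem of a prestate -/

/-- The literals `x_h` and `¬ x_h`, where `x_h` is the closure variable of the formula `h`. -/
inductive Literal (P : Type*) where
  | on (h : Formula P) : Literal P
  | off (h : Formula P) : Literal P

/-- A clause is a disjunction of literals. -/
abbrev Clause (P : Type*) := List (Literal P)

/-- `x_h` is true in the assignment `I` exactly if `h ∈ I` (presence of `h`). -/
def Literal.Sat (I : Set (Formula P)) : Literal P → Prop
  | .on h => h ∈ I
  | .off h => h ∉ I

/-- The unwound clause set `UCS(PS)`. -/
inductive UCS (PS : Set (Formula P)) : Clause P → Prop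
  | presence {h : Formula P} : h ∈ PS → UCS PS [.on h]
  | all {ψ χ : Formula P} {l : List (Formula P)} :
      StCl PS ψ → unwind ψ = .all l → χ ∈ l → UCS PS [.off ψ, .on χ]
  | any {ψ : Formula P} {l : List (Formula P)} :
      StCl PS ψ → unwind ψ = .any l → UCS PS (.off ψ :: l.map .on)

/-- The conflict clauses `AUX(PS)`. -/
inductive AUX (PS : Set (Formula P)) : Clause P → Prop
  | compl {h : Formula P} : StCl PS h → StCl PS (Formula.not h) →
      AUX PS [.off h, .off (Formula.not h)]
  | fls : StCl PS Formula.fls → AUX PS [.off Formula.fls]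

/-- `I` is an instance of the propositional problem `UCS(PS) ∪ AUX(PS)`: an assignment of the
closure variables of `PS`, given by the set of the true ones, that satisfies all the clauses. -/
def IsInstance (PS I : Set (Formula P)) : Prop :=
  (∀ h ∈ I, StCl PS h) ∧ ∀ c : Clause P, UCS PS c ∨ AUX PS c → ∃ x ∈ c, x.Sat I

/-- `h` is the operand of a promise `a U h` (in particular `F h`) of the closure of `f`. -/
def PromiseOperand (f h : Formula P) : Prop := ∃ a, Cl f (untl a h)

/-- `J` arises from `IS` by switching some true variables `x_h`, none of them with `h` a promise
operand of `f`, to false, and `J` is still an instance of the problem of `PS`. -/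
def IsSwitching (f : Formula P) (PS IS J : Set (Formula P)) : Prop :=
  J ⊆ IS ∧ (∀ h ∈ IS, h ∉ J → ¬ PromiseOperand f h) ∧ IsInstance PS J

/-- `I` is a fair prime implicant of the instance `IS`: a switching of `IS` with a maximal set of
switched variables, that is, with a minimal set of remaining true ones. -/
def IsFPIOf (f : Formula P) (PS IS I : Set (Formula P)) : Prop :=
  Minimal (IsSwitching f PS IS) I

/-- `I` is a fair prime implicant (of some instance) for the prestate `PS`. -/
def IsFPI (f : Formula P) (PS I : Set (Formula P)) : Prop :=
  ∃ IS, IsInstance PS IS ∧ IsFPIOf f PS IS I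

/-- The prestate from which the `i`-th state of the path `s` is derived. -/
def prestateAt (f : Formula P) (s : ℕ → Set (Formula P)) : ℕ → Set (Formula P)
  | 0 => initPrestate f
  | i + 1 => nextPrestate (s i)

end LTL

namespace LTL

open Formula

variable {P : Type*}

/-! Semantics of the unwinding rules -/

namespace Formula

/-! From a model `M` to a path: at time `i` consider the states derived from the current prestate
that are true at `i` and contain `b` whenever they contain `a U b` and `b` is true at `i`. Such
fulfilling states exist (choose true alternatives, and `b` whenever possible), and there are
finitely many because `Cl f` is finite. An inclusion-minimal one, `S`, is an FPI of itself: a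
switching `J ⊆ S` keeps all promise operands, so it still contains every operand that is true at `i`
and promised in `J`; hence `J` contains a fulfilling state, and minimality gives `J = S`
(`exists_isFulfillingState_isFPI`). The resulting path is fair: a pending `a U b` is carried along
until `b` becomes true in `M`, and there the state must contain `b`.

From a path to a model: any fair path gives one, by making `p` true at `k` when `var p ∈ s k`;
`IsFairPath.holds` is the truth lemma. -/

theorem holds_iff_conjuncts (M : ℕ → Set P) (i : ℕ) (a : Formula P) :
    Holds M i a ↔ ∀ c ∈ a.conjuncts, Holds M i c := by
  induction a with
  | and a b iha ihb =>
    simp only [conjuncts, List.mem_append, Holds, iha, ihb]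
    exact ⟨fun h c hc => hc.elim (h.1 c) (h.2 c),
      fun h => ⟨fun c hc => h c (.inl hc), fun c hc => h c (.inr hc)⟩⟩
  | _ => simp [conjuncts]

theorem holds_iff_disjuncts (M : ℕ → Set P) (i : ℕ) (a : Formula P) :
    Holds M i a ↔ ∃ c ∈ a.disjuncts, Holds M i c := by
  induction a with
  | or a b iha ihb =>
    simp only [disjuncts, List.mem_append, Holds, iha, ihb, or_and_right, exists_or]
  | _ => simp [disjuncts]

theorem holds_untl_iff (M : ℕ → Set P) (i : ℕ) (a b : Formula P) :
    Holds M i (untl a b) ↔ Holds M i b ∨ Holds M i a ∧ Holds M (i + 1) (untl a b) := by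
  simp only [Holds]
  constructor
  · rintro ⟨j, hij, hb, ha⟩
    rcases hij.eq_or_lt with rfl | hij
    · exact .inl hb
    · exact .inr ⟨ha i le_rfl hij, j, hij, hb, fun k hk => ha k (by lia)⟩
  · rintro (hb | ⟨ha, j, hij, hb, h⟩)
    · exact ⟨i, le_rfl, hb, fun k h₁ h₂ => by lia⟩
    · refine ⟨j, by lia, hb, fun k hk hkj => ?_⟩
      rcases hk.eq_or_lt with rfl | hk
      · exact ha
      · exact h k hk hkj

theorem holds_wuntl_iff (M : ℕ → Set P) (i : ℕ) (a b : Formula P) :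
    Holds M i (wuntl a b) ↔ Holds M i b ∨ Holds M i a ∧ Holds M (i + 1) (wuntl a b) := by
  have e (i : ℕ) : Holds M i (wuntl a b) ↔ (∀ j, i ≤ j → Holds M j a) ∨ Holds M i (untl a b) :=
    Iff.rfl
  rw [e, e, holds_untl_iff]
  constructor
  · rintro (h | h | ⟨ha, h⟩)
    · exact .inr ⟨h i le_rfl, .inl fun j hj => h j (by lia)⟩
    · exact .inl h
    · exact .inr ⟨ha, .inr h⟩
  · rintro (h | ⟨ha, h | h⟩)
    · exact .inr (.inl h)
    · refine .inl fun j hj => ?_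
      rcases hj.eq_or_lt with rfl | hj
      · exact ha
      · exact h j hj
    · exact .inr (.inr ⟨ha, h⟩)

end Formula

/-- Isolates the precedence of the `F` rule, so that later arguments need no case split on `a`. -/
theorem unwind_untl (a b : Formula P) :
    (a = tru ∧ unwind (untl a b) = .any [b, .next (untl a b)]) ∨
      unwind (untl a b) = .any [b, .and a (.next (untl a b))] := by
  cases a <;> simp [unwind]

theorem unwind_wuntl (a b : Formula P) :
    (b = fls ∧ unwind (wuntl a b) = .all [a, .next (wuntl a b)]) ∨
      unwind (wuntl a b) = .any [b, .and a (.next (wuntl a b))] := by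
  cases b <;> simp [unwind]

theorem holds_of_unwind_all {M : ℕ → Set P} {i : ℕ} {ψ : Formula P} {l : List (Formula P)}
    (hl : unwind ψ = .all l) (h : Holds M i ψ) : ∀ χ ∈ l, Holds M i χ := by
  cases ψ with
  | and a b =>
    cases hl
    exact (holds_iff_conjuncts M i _).1 h
  | untl a b => rcases unwind_untl a b with ⟨-, e⟩ | e <;> simp [e] at hl
  | wuntl a b =>
    rcases unwind_wuntl a b with ⟨rfl, e⟩ | e
    · rw [e] at hl
      cases hl
      rw [holds_wuntl_iff] at h
      rcases h with h | h
      · exact h.elim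
      · simpa [Holds] using h
    · simp [e] at hl
  | _ => simp [unwind] at hl

theorem holds_of_unwind_any {M : ℕ → Set P} {i : ℕ} {ψ : Formula P} {l : List (Formula P)}
    (hl : unwind ψ = .any l) (h : Holds M i ψ) : ∃ χ ∈ l, Holds M i χ := by
  cases ψ with
  | or a b =>
    cases hl
    exact (holds_iff_disjuncts M i _).1 h
  | untl a b =>
    rw [holds_untl_iff] at h
    rcases unwind_untl a b with ⟨-, e⟩ | e <;> rw [e] at hl <;> cases hl <;>
      rcases h with h | h
    · exact ⟨b, by simp, h⟩
    · exact ⟨.next (untl a b), by simp, h.2⟩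
    · exact ⟨b, by simp, h⟩
    · exact ⟨.and a (.next (untl a b)), by simp, h⟩
  | wuntl a b =>
    rw [holds_wuntl_iff] at h
    rcases unwind_wuntl a b with ⟨-, e⟩ | e
    · simp [e] at hl
    · rw [e] at hl
      cases hl
      rcases h with h | h
      · exact ⟨b, by simp, h⟩
      · exact ⟨.and a (.next (wuntl a b)), by simp, h⟩
  | _ => simp [unwind] at hl

/-! Sets closed under unwinding, and the states inside them -/

/-- `K` is closed under the unwinding rules, for some choice of the alternatives. -/
def Saturated (K : Set (Formula P)) : Prop :=
  (∀ ψ ∈ K, ∀ l, unwind ψ = .all l → ∀ χ ∈ l, χ ∈ K) ∧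
  (∀ ψ ∈ K, ∀ l, unwind ψ = .any l → ∃ χ ∈ l, χ ∈ K)

/-- No disjunctive unwinding has an empty list of alternatives. This is what makes every prestate
derive at least one state. -/
theorem saturated_univ : Saturated (Set.univ : Set (Formula P)) := by
  refine ⟨fun _ _ _ _ _ _ => trivial, fun ψ _ l hl => ?_⟩
  have hd (a : Formula P) : a.disjuncts ≠ [] := by
    induction a <;> simp_all [disjuncts]
  have hne : l ≠ [] := by
    cases ψ with
    | or a b =>
      cases hl
      exact hd _
    | untl a b =>
      rcases unwind_untl a b with ⟨-, e⟩ | e <;> rw [e] at hl <;> cases hl <;> simp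
    | wuntl a b =>
      rcases unwind_wuntl a b with ⟨-, e⟩ | e <;> rw [e] at hl <;> cases hl
      simp
    | _ => simp [unwind] at hl
  obtain ⟨χ, hχ⟩ := List.exists_mem_of_ne_nil l hne
  exact ⟨χ, hχ, trivial⟩

theorem ClosedUnder.saturated {ρ : Formula P → Formula P} {T : Set (Formula P)}
    (h : ClosedUnder ρ T) : Saturated T :=
  ⟨h.1, fun ψ hψ l hl => ⟨ρ ψ, h.2 ψ hψ l hl⟩⟩

theorem IsStateFrom.saturated {PS S : Set (Formula P)} (h : IsStateFrom PS S) : Saturated S :=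
  let ⟨_, h⟩ := h
  h.1.2.saturated

theorem IsStateFrom.subset {PS S : Set (Formula P)} (h : IsStateFrom PS S) : PS ⊆ S :=
  let ⟨_, h⟩ := h
  h.1.1

/-- Cutting `S` down to `StCl PS` preserves closure under the same choices, so leastness forces `S`
inside it. -/
theorem IsStateFrom.stCl {PS S : Set (Formula P)} (h : IsStateFrom PS S) :
    ∀ ψ ∈ S, StCl PS ψ := by
  obtain ⟨ρ, ⟨hPS, hc⟩, hmin⟩ := h
  have key : S ≤ {ψ | ψ ∈ S ∧ StCl PS ψ} := by
    refine hmin ⟨fun ψ hψ => ⟨hPS hψ, .base hψ⟩, ?_, ?_⟩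
    · intro ψ hψ l hl χ hχ
      exact ⟨hc.1 ψ hψ.1 l hl χ hχ, hψ.2.part (by simpa [hl, Unwinding.parts] using hχ)⟩
    · intro ψ hψ l hl
      obtain ⟨h₁, h₂⟩ := hc.2 ψ hψ.1 l hl
      exact ⟨h₁, h₂, hψ.2.part (by simpa [hl, Unwinding.parts] using h₁)⟩
  exact fun ψ hψ => (key hψ).2

/-- A saturated set containing a prestate contains a state derived from it, which can be chosen to
fulfil every promise whose operand lies in the set. -/
theorem Saturated.exists_isStateFrom {PS K : Set (Formula P)} (hK : Saturated K) (hPS : PS ⊆ K) :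
    ∃ T ⊆ K, IsStateFrom PS T ∧ ∀ a b, untl a b ∈ T → b ∈ K → b ∈ T := by
  -- On `K` the choice is the operand `b` of `a U b` if it lies in `K`, otherwise any alternative in
  -- `K`; outside `K` the value is irrelevant, since the least closed set stays in `K`.
  have hρ : ∀ ψ : Formula P, ∃ χ, ψ ∈ K → (∀ l, unwind ψ = .any l → χ ∈ l ∧ χ ∈ K) ∧
      ∀ a b, ψ = untl a b → b ∈ K → χ = b := by
    intro ψ
    by_cases hψ : ψ ∈ K
    · by_cases hu : ∃ a b, ψ = untl a b ∧ b ∈ K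
      · obtain ⟨a, b, rfl, hb⟩ := hu
        refine ⟨b, fun _ => ⟨fun l hl => ⟨?_, hb⟩, by rintro _ _ ⟨⟩ _; rfl⟩⟩
        rcases unwind_untl a b with ⟨-, e⟩ | e <;> rw [e] at hl <;> cases hl <;> simp
      · by_cases hl : ∃ l, unwind ψ = .any l
        · obtain ⟨l, hl⟩ := hl
          obtain ⟨χ, h₁, h₂⟩ := hK.2 ψ hψ l hl
          refine ⟨χ, fun _ => ⟨fun l' hl' => ?_, fun a b h hb => (hu ⟨a, b, h, hb⟩).elim⟩⟩
          rw [hl] at hl'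
          cases hl'
          exact ⟨h₁, h₂⟩
        · exact ⟨ψ, fun _ => ⟨fun l h => (hl ⟨l, h⟩).elim,
            fun a b h hb => (hu ⟨a, b, h, hb⟩).elim⟩⟩
    · exact ⟨ψ, fun h => (hψ h).elim⟩
  choose ρ hρ using hρ
  have hKc : ClosedUnder ρ K := ⟨hK.1, fun ψ hψ l hl => (hρ ψ hψ).1 l hl⟩
  have hTK : ⋂₀ {T | PS ⊆ T ∧ ClosedUnder ρ T} ⊆ K := Set.sInter_subset_of_mem ⟨hPS, hKc⟩
  have hTc : ClosedUnder ρ (⋂₀ {T | PS ⊆ T ∧ ClosedUnder ρ T}) :=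
    ⟨fun ψ hψ l hl χ hχ T hT => hT.2.1 ψ (hψ T hT) l hl χ hχ,
      fun ψ hψ l hl => ⟨((hρ ψ (hTK hψ)).1 l hl).1, fun T hT => (hT.2.2 ψ (hψ T hT) l hl).2⟩⟩
  refine ⟨_, hTK, ⟨ρ, ⟨Set.subset_sInter fun T hT => hT.1, hTc⟩,
    fun T hT => Set.sInter_subset_of_mem hT⟩, fun a b hab hb => ?_⟩
  have hr := (hρ _ (hTK hab)).2 a b rfl hb
  rcases unwind_untl a b with ⟨-, e⟩ | e <;> exact hr ▸ (hTc.2 _ hab _ e).2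

/-! Saturated sets and membership -/

theorem Saturated.conjuncts_subset {S : Set (Formula P)} (hS : Saturated S) {a : Formula P}
    (ha : a ∈ S) : ∀ c ∈ a.conjuncts, c ∈ S := by
  cases a with
  | and a b => exact hS.1 _ ha _ rfl
  | _ => simpa [conjuncts] using ha

/-- The `F` rule does not put `TRUE` into the state, and the `U` rule flattens `a ∧ X (a U b)`, so
only the conjuncts of `a` are guaranteed, not `a` itself. -/
theorem Saturated.untl_mem {S : Set (Formula P)} (hS : Saturated S) {a b : Formula P}
    (h : untl a b ∈ S) :
    b ∈ S ∨ (a = tru ∨ ∀ c ∈ a.conjuncts, c ∈ S) ∧ next (untl a b) ∈ S := by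
  rcases unwind_untl a b with ⟨ha, e⟩ | e
  · obtain ⟨χ, hχ, hχS⟩ := hS.2 _ h _ e
    rcases List.mem_pair.1 hχ with rfl | rfl
    · exact .inl hχS
    · exact .inr ⟨.inl ha, hχS⟩
  · obtain ⟨χ, hχ, hχS⟩ := hS.2 _ h _ e
    rcases List.mem_pair.1 hχ with rfl | rfl
    · exact .inl hχS
    · have := hS.conjuncts_subset hχS
      simp only [conjuncts, List.mem_append, List.mem_singleton] at this
      exact .inr ⟨.inr fun c hc => this c (.inl hc), this _ (.inr rfl)⟩

theorem Saturated.wuntl_mem {S : Set (Formula P)} (hS : Saturated S) {a b : Formula P}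
    (h : wuntl a b ∈ S) :
    b ∈ S ∨ (∀ c ∈ a.conjuncts, c ∈ S) ∧ next (wuntl a b) ∈ S := by
  rcases unwind_wuntl a b with ⟨-, e⟩ | e
  · have := hS.1 _ h _ e
    simp only [List.mem_pair] at this
    exact .inr ⟨hS.conjuncts_subset (this a (.inl rfl)), this _ (.inr rfl)⟩
  · obtain ⟨χ, hχ, hχS⟩ := hS.2 _ h _ e
    rcases List.mem_pair.1 hχ with rfl | rfl
    · exact .inl hχS
    · have := hS.conjuncts_subset hχS
      simp only [conjuncts, List.mem_append, List.mem_singleton] at this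
      exact .inr ⟨fun c hc => this c (.inl hc), this _ (.inr rfl)⟩

/-! Finiteness of the closure -/

/-- An explicit finite superset of the closure. -/
def closureBound : Formula P → Set (Formula P)
  | .and a b => {.and a b} ∪ (closureBound a ∪ closureBound b)
  | .or a b => {.or a b} ∪ (closureBound a ∪ closureBound b)
  | .next a => {.next a} ∪ closureBound a
  | .untl a b => {.untl a b, .next (.untl a b), .and a (.next (.untl a b))} ∪
      (closureBound a ∪ closureBound b)
  | .wuntl a b => {.wuntl a b, .next (.wuntl a b), .and a (.next (.wuntl a b))} ∪
      (closureBound a ∪ closureBound b)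
  | a => {a}

theorem finite_closureBound (f : Formula P) : (closureBound f).Finite := by
  induction f <;> simp_all [closureBound]

theorem self_mem_closureBound (f : Formula P) : f ∈ closureBound f := by
  cases f <;> simp [closureBound]

theorem conjuncts_subset_closureBound (f : Formula P) : ∀ c ∈ f.conjuncts, c ∈ closureBound f := by
  induction f with
  | and a b iha ihb =>
    intro c hc
    rcases List.mem_append.1 hc with hc | hc
    · exact .inr (.inl (iha c hc))
    · exact .inr (.inr (ihb c hc))
  | _ => simp [conjuncts, closureBound]

theorem disjuncts_subset_closureBound (f : Formula P) : ∀ c ∈ f.disjuncts, c ∈ closureBound f := by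
  induction f with
  | or a b iha ihb =>
    intro c hc
    rcases List.mem_append.1 hc with hc | hc
    · exact .inr (.inl (iha c hc))
    · exact .inr (.inr (ihb c hc))
  | _ => simp [disjuncts, closureBound]

/-- The only formulas produced that are not subformulas are `X ψ` and `a ∧ X ψ`, for `ψ` a `U` or
`W` formula with left operand `a`; these unwind or step back into the same set. -/
theorem closureBound_closed (f : Formula P) : ∀ ψ ∈ closureBound f,
    (∀ χ ∈ (unwind ψ).parts, χ ∈ closureBound f) ∧ ∀ χ, ψ = next χ → χ ∈ closureBound f := by
  have hand (a χ : Formula P) : ∀ c ∈ (unwind (.and a (.next χ))).parts,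
      c ∈ closureBound a ∨ c = .next χ := by
    intro c hc
    rcases List.mem_append.1 (show c ∈ a.conjuncts ++ [.next χ] from hc) with hc | hc
    · exact .inl (conjuncts_subset_closureBound a c hc)
    · exact .inr (List.mem_singleton.1 hc)
  induction f with
  | and a b iha ihb =>
    rintro ψ (rfl | h | h)
    · exact ⟨conjuncts_subset_closureBound (.and a b), by simp⟩
    · exact ⟨fun χ hχ => .inr (.inl ((iha ψ h).1 χ hχ)),
        fun χ hχ => .inr (.inl ((iha ψ h).2 χ hχ))⟩
    · exact ⟨fun χ hχ => .inr (.inr ((ihb ψ h).1 χ hχ)),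
        fun χ hχ => .inr (.inr ((ihb ψ h).2 χ hχ))⟩
  | or a b iha ihb =>
    rintro ψ (rfl | h | h)
    · exact ⟨disjuncts_subset_closureBound (.or a b), by simp⟩
    · exact ⟨fun χ hχ => .inr (.inl ((iha ψ h).1 χ hχ)),
        fun χ hχ => .inr (.inl ((iha ψ h).2 χ hχ))⟩
    · exact ⟨fun χ hχ => .inr (.inr ((ihb ψ h).1 χ hχ)),
        fun χ hχ => .inr (.inr ((ihb ψ h).2 χ hχ))⟩
  | next a iha =>
    rintro ψ (rfl | h)
    · exact ⟨by simp [unwind, Unwinding.parts], by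
        rintro _ ⟨⟩
        exact .inr (self_mem_closureBound _)⟩
    · exact ⟨fun χ hχ => .inr ((iha ψ h).1 χ hχ), fun χ hχ => .inr ((iha ψ h).2 χ hχ)⟩
  | untl a b iha ihb =>
    rintro ψ ((rfl | rfl | rfl) | h | h)
    · refine ⟨?_, by simp⟩
      have hb : b ∈ closureBound (untl a b) := .inr (.inr (self_mem_closureBound b))
      rcases unwind_untl a b with ⟨-, e⟩ | e <;> rw [e] <;>
        simp only [Unwinding.parts, List.mem_pair, forall_eq_or_imp, forall_eq]
      · exact ⟨hb, .inl (.inr (.inl rfl))⟩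
      · exact ⟨hb, .inl (.inr (.inr rfl))⟩
    · exact ⟨by simp [unwind, Unwinding.parts], by
        rintro _ ⟨⟩
        exact self_mem_closureBound _⟩
    · refine ⟨fun c hc => ?_, by simp⟩
      rcases hand _ _ c hc with hc | rfl
      · exact .inr (.inl hc)
      · exact .inl (.inr (.inl rfl))
    · exact ⟨fun χ hχ => .inr (.inl ((iha ψ h).1 χ hχ)),
        fun χ hχ => .inr (.inl ((iha ψ h).2 χ hχ))⟩
    · exact ⟨fun χ hχ => .inr (.inr ((ihb ψ h).1 χ hχ)),
        fun χ hχ => .inr (.inr ((ihb ψ h).2 χ hχ))⟩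
  | wuntl a b iha ihb =>
    rintro ψ ((rfl | rfl | rfl) | h | h)
    · refine ⟨?_, by simp⟩
      have ha : a ∈ closureBound (wuntl a b) := .inr (.inl (self_mem_closureBound a))
      have hb : b ∈ closureBound (wuntl a b) := .inr (.inr (self_mem_closureBound b))
      rcases unwind_wuntl a b with ⟨-, e⟩ | e <;> rw [e] <;>
        simp only [Unwinding.parts, List.mem_pair, forall_eq_or_imp, forall_eq]
      · exact ⟨ha, .inl (.inr (.inl rfl))⟩
      · exact ⟨hb, .inl (.inr (.inr rfl))⟩
    · exact ⟨by simp [unwind, Unwinding.parts], by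
        rintro _ ⟨⟩
        exact self_mem_closureBound _⟩
    · refine ⟨fun c hc => ?_, by simp⟩
      rcases hand _ _ c hc with hc | rfl
      · exact .inr (.inl hc)
      · exact .inl (.inr (.inl rfl))
    · exact ⟨fun χ hχ => .inr (.inl ((iha ψ h).1 χ hχ)),
        fun χ hχ => .inr (.inl ((iha ψ h).2 χ hχ))⟩
    · exact ⟨fun χ hχ => .inr (.inr ((ihb ψ h).1 χ hχ)),
        fun χ hχ => .inr (.inr ((ihb ψ h).2 χ hχ))⟩
  | _ =>
    rintro ψ rfl
    simp [unwind, Unwinding.parts]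

theorem finite_cl (f : Formula P) : {ψ | Cl f ψ}.Finite := by
  refine (finite_closureBound f).subset fun ψ hψ => ?_
  induction hψ with
  | base => exact self_mem_closureBound f
  | part _ h ih => exact (closureBound_closed f _ ih).1 _ h
  | next _ ih => exact (closureBound_closed f _ ih).2 _ rfl

theorem cl_of_stCl {f : Formula P} {PS : Set (Formula P)} (h : ∀ ψ ∈ PS, Cl f ψ)
    {ψ : Formula P} (hψ : StCl PS ψ) : Cl f ψ := by
  induction hψ with
  | base hψ => exact h _ hψ
  | part _ hχ ih => exact ih.part hχ

theorem cl_of_mem_initPrestate {f ψ : Formula P} (h : ψ ∈ initPrestate f) : Cl f ψ := by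
  cases f with
  | and a b => exact Cl.base.part (by simpa [unwind, Unwinding.parts, initPrestate] using h)
  | _ =>
    obtain rfl : ψ = _ := by simpa [initPrestate, conjuncts] using h
    exact .base

/-! Instances -/

/-- The clauses of `UCS` express containment of `PS` and saturation, those of `AUX` the absence of
conflicts. -/
theorem isInstance_of_saturated {PS S : Set (Formula P)} (hsat : Saturated S) (hPS : PS ⊆ S)
    (hcl : ∀ ψ ∈ S, StCl PS ψ) (hS : ¬ Conflicting S) : IsInstance PS S := by
  refine ⟨hcl, ?_⟩
  rintro c (hc | hc)
  · cases hc with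
    | presence h => exact ⟨_, List.mem_singleton.2 rfl, hPS h⟩
    | @all ψ χ l _ hl hχ =>
      by_cases hψ : ψ ∈ S
      · exact ⟨.on χ, by simp, hsat.1 ψ hψ l hl χ hχ⟩
      · exact ⟨.off ψ, by simp, hψ⟩
    | @any ψ l _ hl =>
      by_cases hψ : ψ ∈ S
      · obtain ⟨χ, hχ, hχS⟩ := hsat.2 ψ hψ l hl
        exact ⟨.on χ, by simp [hχ], hχS⟩
      · exact ⟨.off ψ, by simp, hψ⟩
  · cases hc with
    | @compl h _ _ =>
      by_cases hh : h ∈ S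
      · exact ⟨.off (.not h), by simp, fun hn => hS (.inr ⟨h, hh, hn⟩)⟩
      · exact ⟨.off h, by simp, hh⟩
    | fls _ => exact ⟨_, List.mem_singleton.2 rfl, fun h => hS (.inl h)⟩

theorem IsInstance.subset {PS J : Set (Formula P)} (h : IsInstance PS J) : PS ⊆ J := by
  intro ψ hψ
  obtain ⟨x, hx, hs⟩ := h.2 _ (.inl (.presence hψ))
  cases List.mem_singleton.1 hx
  exact hs

theorem IsInstance.saturated {PS J : Set (Formula P)} (h : IsInstance PS J) : Saturated J := by
  constructor
  · intro ψ hψ l hl χ hχ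
    obtain ⟨x, hx, hs⟩ := h.2 _ (.inl (.all (h.1 ψ hψ) hl hχ))
    rcases List.mem_pair.1 hx with rfl | rfl
    · exact (hs hψ).elim
    · exact hs
  · intro ψ hψ l hl
    obtain ⟨x, hx, hs⟩ := h.2 _ (.inl (.any (h.1 ψ hψ) hl))
    rcases List.mem_cons.1 hx with rfl | hx
    · exact (hs hψ).elim
    · obtain ⟨χ, hχ, rfl⟩ := List.mem_map.1 hx
      exact ⟨χ, hχ, hs⟩

/-! From a model to a path -/

theorem not_conflicting_of_holds {M : ℕ → Set P} {i : ℕ} {S : Set (Formula P)}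
    (h : ∀ ψ ∈ S, Holds M i ψ) : ¬ Conflicting S := by
  rintro (hf | ⟨a, ha, hn⟩)
  · exact h _ hf
  · exact h _ hn (h _ ha)

/-- A state derived from `PS` that is true at time `i` of `M` and fulfils all the promises whose
operand is true there. -/
structure IsFulfillingState (M : ℕ → Set P) (i : ℕ) (PS S : Set (Formula P)) : Prop where
  isStateFrom : IsStateFrom PS S
  holds : ∀ ψ ∈ S, Holds M i ψ
  fulfils : ∀ a b, untl a b ∈ S → Holds M i b → b ∈ S

/-- Applied with `K` the set of all formulas true at `i`, for existence, and with `K` a switching of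
a minimal fulfilling state, for the FPI property. -/
theorem exists_isFulfillingState_subset {M : ℕ → Set P} {i : ℕ} {PS K : Set (Formula P)}
    (hK : Saturated K) (hPS : PS ⊆ K) (hholds : ∀ ψ ∈ K, Holds M i ψ)
    (hful : ∀ a b, untl a b ∈ K → Holds M i b → b ∈ K) :
    ∃ T ⊆ K, IsFulfillingState M i PS T := by
  obtain ⟨T, hTK, hT, hU⟩ := hK.exists_isStateFrom hPS
  exact ⟨T, hTK, hT, fun ψ hψ => hholds ψ (hTK hψ),
    fun a b hab hb => hU a b hab (hful a b (hTK hab) hb)⟩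

/-- Inclusion-minimal fulfilling states are fair prime implicants of themselves. -/
theorem exists_isFulfillingState_isFPI {f : Formula P} {M : ℕ → Set P} {i : ℕ}
    {PS : Set (Formula P)} (hcl : ∀ ψ ∈ PS, Cl f ψ) (hM : ∀ ψ ∈ PS, Holds M i ψ) :
    ∃ S, IsFulfillingState M i PS S ∧ IsFPI f PS S := by
  have hScl {S : Set (Formula P)} (hS : IsFulfillingState M i PS S) : ∀ ψ ∈ S, Cl f ψ :=
    fun ψ hψ => cl_of_stCl hcl (hS.isStateFrom.stCl ψ hψ)
  have hfin : {S | IsFulfillingState M i PS S}.Finite :=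
    (finite_cl f).finite_subsets.subset fun S hS => hScl hS
  have hne : {S | IsFulfillingState M i PS S}.Nonempty := by
    obtain ⟨S, -, hS⟩ := exists_isFulfillingState_subset (M := M) (i := i)
      (K := {ψ | Holds M i ψ}) ⟨fun ψ hψ l hl => holds_of_unwind_all hl hψ,
        fun ψ hψ l hl => holds_of_unwind_any hl hψ⟩ hM (fun _ h => h) (fun _ _ _ h => h)
    exact ⟨S, hS⟩
  obtain ⟨S, hS⟩ := hfin.exists_minimal hne
  have hSf : IsFulfillingState M i PS S := hS.prop
  have hinst : IsInstance PS S := isInstance_of_saturated hSf.isStateFrom.saturated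
    hSf.isStateFrom.subset hSf.isStateFrom.stCl (not_conflicting_of_holds hSf.holds)
  refine ⟨S, hSf, S, hinst, ⟨subset_rfl, fun h h₁ h₂ => (h₂ h₁).elim, hinst⟩, ?_⟩
  rintro J ⟨hJS, hJ, hJi⟩ -
  obtain ⟨T, hTJ, hT⟩ := exists_isFulfillingState_subset (M := M) (i := i) hJi.saturated
    -- Here the ban on switching promise operands enters: `b ∈ S` is promised by `a U b`, so it
    -- cannot have been removed from `J`.
    hJi.subset (fun ψ hψ => hSf.holds ψ (hJS hψ)) (fun a b hab hb => by
      by_contra hbJ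
      exact hJ b (hSf.fulfils a b (hJS hab) hb) hbJ ⟨a, hScl hSf _ (hJS hab)⟩)
  exact (hS.le_of_le hT (hTJ.trans hJS)).trans hTJ

theorem exists_sequence {f : Formula P} {M : ℕ → Set P} (hM : Holds M 0 f) :
    ∃ s : ℕ → Set (Formula P), ∀ i, IsFulfillingState M i (prestateAt f s i) (s i) ∧
      IsFPI f (prestateAt f s i) (s i) := by
  have hex (i : ℕ) (PS : Set (Formula P)) : ∃ S,
      (∀ ψ ∈ PS, Cl f ψ) → (∀ ψ ∈ PS, Holds M i ψ) →
        IsFulfillingState M i PS S ∧ IsFPI f PS S := by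
    by_cases h : (∀ ψ ∈ PS, Cl f ψ) ∧ ∀ ψ ∈ PS, Holds M i ψ
    · obtain ⟨S, hS⟩ := exists_isFulfillingState_isFPI h.1 h.2
      exact ⟨S, fun _ _ => hS⟩
    · exact ⟨∅, fun h₁ h₂ => (h ⟨h₁, h₂⟩).elim⟩
  choose g hg using hex
  -- The recursion runs through all times, even past an empty prestate; the surplus is cut off by
  -- `exists_length`.
  let s : ℕ → Set (Formula P) := fun n =>
    Nat.rec (g 0 (initPrestate f)) (fun i S => g (i + 1) (nextPrestate S)) n
  have hs (i : ℕ) : s i = g i (prestateAt f s i) := by cases i <;> rfl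
  have hpre (i : ℕ) : (∀ ψ ∈ prestateAt f s i, Cl f ψ) ∧
      ∀ ψ ∈ prestateAt f s i, Holds M i ψ := by
    induction i with
    | zero => exact ⟨fun ψ => cl_of_mem_initPrestate, (holds_iff_conjuncts M 0 f).1 hM⟩
    | succ i ih =>
      have := (hg i _ ih.1 ih.2).1
      rw [← hs] at this
      exact ⟨fun ψ hψ => .next (cl_of_stCl ih.1 (this.isStateFrom.stCl _ hψ)),
        fun ψ hψ => this.holds (.next ψ) hψ⟩
  refine ⟨s, fun i => ?_⟩
  have := hg i _ (hpre i).1 (hpre i).2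
  rwa [← hs] at this

/-- Truncation of a sequence at the first index at which `p` fails. -/
theorem exists_length (p : ℕ → Prop) : ∃ N : ℕ∞, 0 < N ∧
    (∀ i : ℕ, (i : ℕ∞) < N → (((i + 1 : ℕ) : ℕ∞) < N ↔ p i)) := by
  classical
  by_cases h : ∃ i, ¬ p i
  -- The first failing index itself is kept, as the last state of the path.
  · refine ⟨((Nat.find h + 1 : ℕ) : ℕ∞), by simp, fun i hi => ?_⟩
    rw [Nat.cast_lt] at hi ⊢
    constructor
    · intro hlt
      exact not_not.1 (Nat.find_min h (by lia))
    · intro hp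
      have : i ≠ Nat.find h := fun e => Nat.find_spec h (e ▸ hp)
      lia
  · push Not at h
    exact ⟨⊤, by simp, fun i _ => ⟨fun _ => h i, fun _ => ENat.natCast_lt_top _⟩⟩

theorem exists_fairPath_of_holds {f : Formula P} {M : ℕ → Set P} (hM : Holds M 0 f) :
    ∃ (N : ℕ∞) (s : ℕ → Set (Formula P)), IsFairPath f N s ∧
      ∀ i : ℕ, (i : ℕ∞) < N → IsFPI f (prestateAt f s i) (s i) := by
  obtain ⟨s, hs⟩ := exists_sequence hM
  obtain ⟨N, hN, hlen⟩ := exists_length fun i => (nextPrestate (s i)).Nonempty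
  have hlt (i : ℕ) (h : ((i + 1 : ℕ) : ℕ∞) < N) : (i : ℕ∞) < N :=
    lt_trans (Nat.cast_lt.2 i.lt_succ_self) h
  refine ⟨N, s, ⟨⟨hN, (hs 0).1.isStateFrom, fun i hi => ?_, ?_⟩, fun i _ =>
    not_conflicting_of_holds (hs i).1.holds, ?_⟩, fun i _ => (hs i).2⟩
  · exact ⟨(hlen i (hlt i hi)).1 hi, (hs (i + 1)).1.isStateFrom⟩
  · rintro i rfl S' ⟨hne, -⟩
    exact lt_irrefl _ ((hlen i (Nat.cast_lt.2 i.lt_succ_self)).2 hne)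
  · intro i hi a b hab
    obtain ⟨j, hij, hb, -⟩ := (hs i).1.holds _ hab
    by_contra! hno
    -- If `b` never appears, `a U b` is postponed by `X` forever, so the path never stops and
    -- reaches the time `j` at which `b` is true in `M`.
    have hmem (k : ℕ) : ((i + k : ℕ) : ℕ∞) < N ∧ untl a b ∈ s (i + k) := by
      induction k with
      | zero => exact ⟨hi, hab⟩
      | succ k ih =>
        rcases (hs (i + k)).1.isStateFrom.saturated.untl_mem ih.2 with h | ⟨-, h⟩
        · exact (hno _ (by lia) ih.1 h).elim
        · exact ⟨(hlen _ ih.1).2 ⟨_, h⟩, (hs (i + k + 1)).1.isStateFrom.subset h⟩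
    obtain ⟨k, rfl⟩ := Nat.exists_eq_add_of_le hij
    exact hno _ hij (hmem k).1 ((hs _).1.fulfils a b (hmem k).2 hb)

/-! From a fair path to a model -/

theorem IsPath.saturated {f : Formula P} {N : ℕ∞} {s : ℕ → Set (Formula P)} (h : IsPath f N s)
    {i : ℕ} (hi : (i : ℕ∞) < N) : Saturated (s i) := by
  cases i with
  | zero => exact h.start.saturated
  | succ i => exact (h.step i hi).2.saturated

/-- A state containing some `X a` always has a successor, so it cannot be the last one. -/
theorem IsPath.next_mem {f : Formula P} {N : ℕ∞} {s : ℕ → Set (Formula P)} (h : IsPath f N s)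
    {i : ℕ} (hi : (i : ℕ∞) < N) {a : Formula P} (ha : next a ∈ s i) :
    ((i + 1 : ℕ) : ℕ∞) < N ∧ a ∈ s (i + 1) := by
  have hle : ((i + 1 : ℕ) : ℕ∞) ≤ N := by
    simpa using Order.add_one_le_of_lt hi
  rcases hle.eq_or_lt with e | hlt
  · obtain ⟨T, -, hT, -⟩ := saturated_univ.exists_isStateFrom (Set.subset_univ (nextPrestate (s i)))
    exact (h.last i e.symm T ⟨⟨a, ha⟩, hT⟩).elim
  · exact ⟨hlt, (h.step i hlt).2.subset ha⟩

/-- Unwinding flattens nested conjunctions and disjunctions, skipping the intermediate subformulas;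
the induction therefore needs both a version for all conjuncts and one for some disjunct. Values of
`s` beyond `N` are arbitrary but harmless: the membership claims stay below `N`, as `X` formulas
never point past the end. -/
theorem IsFairPath.holds {f : Formula P} {N : ℕ∞} {s : ℕ → Set (Formula P)}
    (h : IsFairPath f N s) {a : Formula P} (hnnf : a.IsNNF) (i : ℕ) (hi : (i : ℕ∞) < N) :
    ((∀ c ∈ a.conjuncts, c ∈ s i) → Holds (fun k => {p | var p ∈ s k}) i a) ∧
      ((∃ d ∈ a.disjuncts, d ∈ s i) → Holds (fun k => {p | var p ∈ s k}) i a) := by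
  have hp := h.toIsPath
  induction a generalizing i with
  | tru => exact ⟨fun _ => trivial, fun _ => trivial⟩
  | fls =>
    have : fls ∉ s i := fun hf => h.nonconflicting i hi (.inl hf)
    simp [conjuncts, disjuncts, this]
  | var p => simp [conjuncts, disjuncts, Holds]
  | not a =>
    cases a with
    | var p =>
      have : not (var p) ∈ s i → var p ∉ s i :=
        fun h₁ h₂ => h.nonconflicting i hi (.inr ⟨_, h₂, h₁⟩)
      simpa [conjuncts, disjuncts, Holds] using this
    | _ => exact hnnf.elim
  | and a b iha ihb =>
    have key : (∀ c ∈ (Formula.and a b).conjuncts, c ∈ s i) →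
        Holds (fun k => {p | var p ∈ s k}) i (.and a b) := fun hc =>
      ⟨(iha hnnf.1 i hi).1 fun c h => hc c (List.mem_append_left _ h),
        (ihb hnnf.2 i hi).1 fun c h => hc c (List.mem_append_right _ h)⟩
    refine ⟨key, ?_⟩
    rintro ⟨d, hd, hds⟩
    cases List.mem_singleton.1 hd
    exact key ((hp.saturated hi).conjuncts_subset hds)
  | or a b iha ihb =>
    have key : (∃ d ∈ (Formula.or a b).disjuncts, d ∈ s i) →
        Holds (fun k => {p | var p ∈ s k}) i (.or a b) := by
      rintro ⟨d, hd, hds⟩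
      rcases List.mem_append.1 hd with hd | hd
      · exact .inl ((iha hnnf.1 i hi).2 ⟨d, hd, hds⟩)
      · exact .inr ((ihb hnnf.2 i hi).2 ⟨d, hd, hds⟩)
    exact ⟨fun hc => key ((hp.saturated hi).2 _ (hc _ (List.mem_singleton.2 rfl)) _ rfl), key⟩
  | next a iha =>
    have key : next a ∈ s i → Holds (fun k => {p | var p ∈ s k}) i (.next a) := fun ha =>
      have hn := hp.next_mem hi ha
      (iha hnnf _ hn.1).1 ((hp.saturated hn.1).conjuncts_subset hn.2)
    simpa [conjuncts, disjuncts] using key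
  | untl a b iha ihb =>
    have key : untl a b ∈ s i → Holds (fun k => {p | var p ∈ s k}) i (.untl a b) := by
      intro hab
      classical
      have hex := h.fulfilled i hi a b hab
      obtain ⟨hij, hj, hb⟩ := Nat.find_spec hex
      -- Taking the first fulfilment `j` ensures that up to `j` the formula was always postponed, so
      -- `a` holds strictly before `j`.
      have hmin {m : ℕ} := Nat.find_min hex (m := m)
      set j := Nat.find hex
      have hmem (k : ℕ) (hik : i ≤ k) (hkj : k ≤ j) : (k : ℕ∞) < N ∧ untl a b ∈ s k := by
        induction k, hik using Nat.le_induction with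
        | base => exact ⟨hi, hab⟩
        | succ k hik ih =>
          have hk := ih (by lia)
          rcases (hp.saturated hk.1).untl_mem hk.2 with hbk | ⟨-, hn⟩
          · exact (hmin hkj ⟨hik, hk.1, hbk⟩).elim
          · exact hp.next_mem hk.1 hn
      refine ⟨j, hij, (ihb hnnf.2 j hj).1 ((hp.saturated hj).conjuncts_subset hb),
        fun k hik hkj => ?_⟩
      have hk := hmem k hik hkj.le
      rcases (hp.saturated hk.1).untl_mem hk.2 with hbk | ⟨rfl | ha, -⟩
      · exact (hmin hkj ⟨hik, hk.1, hbk⟩).elim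
      · exact trivial
      · exact (iha hnnf.1 k hk.1).1 ha
    simpa [conjuncts, disjuncts] using key
  | wuntl a b iha ihb =>
    have key : wuntl a b ∈ s i → Holds (fun k => {p | var p ∈ s k}) i (.wuntl a b) := by
      intro hab
      by_cases hex : ∃ j, i ≤ j ∧ (j : ℕ∞) < N ∧ b ∈ s j
      · classical
        obtain ⟨hij, hj, hb⟩ := Nat.find_spec hex
        have hmin {m : ℕ} := Nat.find_min hex (m := m)
        set j := Nat.find hex
        have hmem (k : ℕ) (hik : i ≤ k) (hkj : k ≤ j) : (k : ℕ∞) < N ∧ wuntl a b ∈ s k := by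
          induction k, hik using Nat.le_induction with
          | base => exact ⟨hi, hab⟩
          | succ k hik ih =>
            have hk := ih (by lia)
            rcases (hp.saturated hk.1).wuntl_mem hk.2 with hbk | ⟨-, hn⟩
            · exact (hmin hkj ⟨hik, hk.1, hbk⟩).elim
            · exact hp.next_mem hk.1 hn
        refine .inr ⟨j, hij, (ihb hnnf.2 j hj).1 ((hp.saturated hj).conjuncts_subset hb),
          fun k hik hkj => ?_⟩
        have hk := hmem k hik hkj.le
        rcases (hp.saturated hk.1).wuntl_mem hk.2 with hbk | ⟨ha, -⟩
        · exact (hmin hkj ⟨hik, hk.1, hbk⟩).elim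
        · exact (iha hnnf.1 k hk.1).1 ha
      -- Without `b` the formula is postponed forever, so the path is infinite and `a` holds at all
      -- later times.
      · have hmem (k : ℕ) (hik : i ≤ k) : (k : ℕ∞) < N ∧ wuntl a b ∈ s k := by
          induction k, hik using Nat.le_induction with
          | base => exact ⟨hi, hab⟩
          | succ k hik hk =>
            rcases (hp.saturated hk.1).wuntl_mem hk.2 with hbk | ⟨-, hn⟩
            · exact (hex ⟨k, hik, hk.1, hbk⟩).elim
            · exact hp.next_mem hk.1 hn
        refine .inl fun k hik => ?_
        have hk := hmem k hik
        rcases (hp.saturated hk.1).wuntl_mem hk.2 with hbk | ⟨ha, -⟩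
        · exact (hex ⟨k, hik, hk.1, hbk⟩).elim
        · exact (iha hnnf.1 k hk.1).1 ha
    simpa [conjuncts, disjuncts] using key

end LTL

theorem mainTheorem4 {P : Type*} (f : LTL.Formula P) (hf : f.IsNNF) :
    f.Satisfiable ↔
      ∃ (N : ℕ∞) (s : ℕ → Set (LTL.Formula P)),
        LTL.IsFairPath f N s ∧
        ∀ i : ℕ, (i : ℕ∞) < N → LTL.IsFPI f (LTL.prestateAt f s i) (s i) := by
  constructor
  · rintro ⟨M, hM⟩
    exact LTL.exists_fairPath_of_holds hM
  · rintro ⟨N, s, h, -⟩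
    exact ⟨_, (h.holds hf 0 h.pos).1 h.start.subset⟩
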